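/- Let $\mathcal{S}$ be an operator system, that is, a norm-closed self-adjoint linear subspace of a nonzero unital C*-algebra $A$ which contains the unit of $A$, and let $C^*(\mathcal{S})$ be the C*-subalgebra of $A$ generated by $\mathcal{S}$. A boundary representation of $\mathcal{S}$ is an irreducible unital $*$-representation $\pi : C^*(\mathcal{S}) \to B(H)$ on a Hilbert space $H \neq 0$ such that $\pi$ is the only unital completely positive map $C^*(\mathcal{S}) \to B(H)$ which agrees with $\pi$ on $\mathcal{S}$. For every $n$ and every matrix $S = [s_{ij}] \in M_n(\mathcal{S})$ there is a boundary representation $\pi$ of $\mathcal{S}$ such that $$\|\pi^{(n)}(S)\| = \|S\|,$$ where $\pi^{(n)}(S) = [\pi(s_{ij})] \in M_n(B(H))$, and the norms are the C*-norms of $M_n(C^*(\mathcal{S}))$ and $M_n(B(H))$. -/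

import Mathlib

open scoped CStarAlgebra

universe u v

/-- A (concrete) operator system in a unital C⋆-algebra `A`: a norm-closed self-adjoint linear
subspace of `A` that contains the unit of `A`. -/
structure OperatorSystem (A : Type u) [CStarAlgebra A] extends Submodule ℂ A where
  one_mem' : (1 : A) ∈ carrier
  star_mem' : ∀ {a : A}, a ∈ carrier → star a ∈ carrier
  isClosed' : IsClosed carrier

namespace OperatorSystem

variable {A : Type u} [CStarAlgebra A]

/-- The C⋆-algebra `C*(𝒮)` generated by the operator system `𝒮` inside the ambient C⋆-algebra:
the norm closure of the unital star-subalgebra generated by `𝒮`. -/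
def cstar (S : OperatorSystem A) : StarSubalgebra ℂ A :=
  (StarAlgebra.adjoin ℂ (S.toSubmodule : Set A)).topologicalClosure

instance isClosed_cstar (S : OperatorSystem A) : IsClosed (S.cstar : Set A) :=
  StarSubalgebra.isClosed_topologicalClosure _

/-- The usual order of the C⋆-algebra `C*(𝒮)`: `a ≤ b` iff `b - a` is self-adjoint with
nonnegative spectrum (equivalently, of the form `star c * c`). -/
noncomputable instance instPartialOrderCstar (S : OperatorSystem A) : PartialOrder S.cstar :=
  CStarAlgebra.spectralOrder S.cstar

instance instStarOrderedRingCstar (S : OperatorSystem A) : StarOrderedRing S.cstar :=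
  CStarAlgebra.spectralOrderedRing S.cstar

theorem mem_cstar (S : OperatorSystem A) {a : A} (ha : a ∈ S.toSubmodule) : a ∈ S.cstar :=
  StarSubalgebra.le_topologicalClosure _ (StarAlgebra.subset_adjoin ℂ _ ha)

/-- The inclusion of the operator system `𝒮` into `C*(𝒮)`. -/
def incl (S : OperatorSystem A) : S.toSubmodule →ₗ[ℂ] S.cstar where
  toFun s := ⟨s, S.mem_cstar s.2⟩
  map_add' _ _ := rfl
  map_smul' _ _ := rfl

end OperatorSystem

/-- A unital star-representation `π` of `B` on the Hilbert space `H` is irreducible if `H ≠ 0` and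
the only closed subspaces of `H` invariant under `π(B)` are `0` and `H`. -/
structure IsIrreducibleRep {B : Type u} [CStarAlgebra B] {H : Type v} [NormedAddCommGroup H]
    [InnerProductSpace ℂ H] [CompleteSpace H] (π : B →⋆ₐ[ℂ] (H →L[ℂ] H)) : Prop where
  nontrivial : Nontrivial H
  eq_bot_or_eq_top : ∀ K : Submodule ℂ H, IsClosed (K : Set H) →
    (∀ b : B, ∀ x ∈ K, π b x ∈ K) → K = ⊥ ∨ K = ⊤

/-- A boundary representation of the operator system `𝒮` is an irreducible star-representation `π`
of `C*(𝒮)` whose restriction to `𝒮` has the unique extension property: `π` is the only unital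
completely positive map on `C*(𝒮)` that agrees with `π` on `𝒮`. -/
structure OperatorSystem.IsBoundaryRepresentation {A : Type u} [CStarAlgebra A]
    (S : OperatorSystem A) {H : Type v} [NormedAddCommGroup H] [InnerProductSpace ℂ H]
    [CompleteSpace H] (π : S.cstar →⋆ₐ[ℂ] (H →L[ℂ] H)) : Prop where
  irreducible : IsIrreducibleRep π
  unique_extension : ∀ ψ : S.cstar →CP (H →L[ℂ] H), ψ 1 = 1 →
    (∀ s : S.toSubmodule, ψ (S.incl s) = π (S.incl s)) → ∀ a : S.cstar, ψ a = π a

open scoped InnerProductSpace ComplexOrder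

/-! Take vectors η_i of total squared norm one in a representation θ of C*(𝒮) and apply words in
elements of 𝒮 to them. The moments ⟪ξ_w, θ(b) ξ_w'⟫ form a positive definite kernel. The class
`IsMomentKernel` is wider: the vector of the word s·w need only be the compression of θ(s)ξ_w to the
closed span of all word vectors. This class is compact for pointwise convergence
(`isCompact_setOf_isMomentKernel`), so it has a lexicographic maximum: first for the total squared
norm of the matrix applied to the η_i, then for the squared norms of all linear combinations of
words, by increasing length.

The GNS representation of a maximal kernel is the boundary representation. The key is rigidity
(`IsLexMaxKernel.eq_wordVec`): in a dilation, once shorter words agree, a genuine word projects onto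
the prescribed vector, so combinations can only become longer; maximality forbids this and forces
equality, one length after another. A unital completely positive map that agrees with the
representation on 𝒮 has a Stinespring dilation, which rigidity makes trivial on the dense span of
the words; this is unique extension.

For irreducibility, a reducing subspace with projection P writes the quadratic form of the kernel as
a convex combination of those of two moment kernels. Extremality of the maximum gives ‖Px‖² = t‖x‖²;
for 0 < t < 1 this forces P = 0, and the end cases t = 0, 1 are immediate.

For the norm, a state on the matrix algebra yields a moment kernel whose first function is at least
‖S‖² (`CStarMatrix.exists_rep_norm_le`), and the maximal kernel does no worse. -/

theorem CStarAlgebra.exists_norm_sq_sub {D : Type*} [CStarAlgebra D] (b : D) :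
    ∃ d : D, algebraMap ℝ D (‖b‖ ^ 2) - star b * b = star d * d := by
  let _ : PartialOrder D := CStarAlgebra.spectralOrder D
  have : StarOrderedRing D := CStarAlgebra.spectralOrderedRing D
  refine CStarAlgebra.nonneg_iff_eq_star_mul_self.mp (sub_nonneg.mpr ?_)
  have := IsSelfAdjoint.le_algebraMap_norm_self (IsSelfAdjoint.star_mul_self b)
  rwa [CStarRing.norm_star_mul_self, ← sq] at this

/-! ### GNS construction for kernels valued in functionals on a C⋆-algebra -/

section KernelGNS

variable {B : Type*} [CStarAlgebra B] {X : Type*}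

/-- The sesquilinear form on finitely supported functions `X →₀ B` attached to a family of
functionals on `B` indexed by `X × X`. -/
noncomputable def kernelForm (k : X → X → B → ℂ) (u v : X →₀ B) : ℂ :=
  u.sum fun x a => v.sum fun y b => k x y (star a * b)

/-- A kernel on `X` with values in the linear functionals on `B` that is positive definite. -/
structure IsPosDefKernel (k : X → X → B → ℂ) : Prop where
  map_add : ∀ x y a b, k x y (a + b) = k x y a + k x y b
  map_smul : ∀ x y (c : ℂ) a, k x y (c • a) = c * k x y a
  map_star : ∀ x y a, k y x (star a) = star (k x y a)
  nonneg : ∀ u, 0 ≤ (kernelForm k u u).re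

namespace IsPosDefKernel

variable {k : X → X → B → ℂ} (hk : IsPosDefKernel k)

theorem map_zero (hk : IsPosDefKernel k) (x y : X) : k x y 0 = 0 := by
  simpa using hk.map_smul x y 0 0

/-- The pre-Hilbert space of a positive definite kernel. -/
def PreSpace (_ : IsPosDefKernel k) := X →₀ B

noncomputable instance : AddCommGroup hk.PreSpace := inferInstanceAs (AddCommGroup (X →₀ B))
noncomputable instance : Module ℂ hk.PreSpace := inferInstanceAs (Module ℂ (X →₀ B))

/-- Finitely supported functions as elements of the pre-Hilbert space. -/
noncomputable def ofFinsupp : (X →₀ B) →ₗ[ℂ] hk.PreSpace := (LinearMap.id : (X →₀ B) →ₗ[ℂ] (X →₀ B))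

theorem form_add_left (hk : IsPosDefKernel k) (u v w : X →₀ B) :
    kernelForm k (u + v) w = kernelForm k u w + kernelForm k v w := by
  unfold kernelForm
  refine Finsupp.sum_add_index' (fun x => ?_) (fun x a b => ?_)
  · simp [hk.map_zero, Finsupp.sum]
  · simp [add_mul, hk.map_add, Finsupp.sum, Finset.sum_add_distrib]

theorem form_smul_left (hk : IsPosDefKernel k) (c : ℂ) (u w : X →₀ B) :
    kernelForm k (c • u) w = star c * kernelForm k u w := by
  unfold kernelForm
  rw [Finsupp.sum_smul_index' (fun x => by simp [hk.map_zero, Finsupp.sum])]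
  simp [Finsupp.sum, Finset.mul_sum, hk.map_smul]

theorem form_star (hk : IsPosDefKernel k) (u v : X →₀ B) : star (kernelForm k v u) = kernelForm k u v := by
  unfold kernelForm
  simp only [Finsupp.sum, star_sum, ← hk.map_star, star_mul, star_star]
  exact Finset.sum_comm

/-- The pre-inner product of a positive definite kernel. -/
noncomputable abbrev core : PreInnerProductSpace.Core ℂ hk.PreSpace where
  inner u v := kernelForm k (show X →₀ B from u) v
  conj_inner_symm u v := hk.form_star u v
  re_inner_nonneg u := hk.nonneg u
  add_left u v w := hk.form_add_left u v w
  smul_left u w c := hk.form_smul_left c u w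

noncomputable instance : SeminormedAddCommGroup hk.PreSpace :=
  InnerProductSpace.Core.toSeminormedAddCommGroup (c := hk.core)
noncomputable instance : InnerProductSpace ℂ hk.PreSpace :=
  InnerProductSpace.ofCore hk.core

/-- Left multiplication by `b`, entry by entry. -/
noncomputable def leftMul (b : B) : hk.PreSpace →ₗ[ℂ] hk.PreSpace :=
  (Finsupp.mapRange.linearMap (LinearMap.mulLeft ℂ b) : (X →₀ B) →ₗ[ℂ] (X →₀ B))

theorem form_leftMul_right (hk : IsPosDefKernel k) (b : B) (u v : X →₀ B) :
    kernelForm k u (Finsupp.mapRange.linearMap (LinearMap.mulLeft ℂ b) v) =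
      kernelForm k (Finsupp.mapRange.linearMap (LinearMap.mulLeft ℂ (star b)) u) v := by
  unfold kernelForm
  simp only [Finsupp.mapRange.linearMap_apply]
  rw [Finsupp.sum_mapRange_index (fun x => by simp [hk.map_zero, Finsupp.sum])]
  refine Finsupp.sum_congr fun x _ => ?_
  rw [Finsupp.sum_mapRange_index (fun x => by simp [hk.map_zero])]
  simp [mul_assoc]

theorem inner_leftMul_right (b : B) (u v : hk.PreSpace) :
    ⟪u, hk.leftMul b v⟫_ℂ = ⟪hk.leftMul (star b) u, v⟫_ℂ :=
  hk.form_leftMul_right b u v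

theorem leftMul_mul (a b : B) (u : hk.PreSpace) :
    hk.leftMul (a * b) u = hk.leftMul a (hk.leftMul b u) := by
  refine Finsupp.ext (M := B) fun x => ?_
  exact mul_assoc a b _

theorem leftMul_add (a b : B) (u : hk.PreSpace) :
    hk.leftMul (a + b) u = hk.leftMul a u + hk.leftMul b u := by
  refine Finsupp.ext (M := B) fun x => ?_
  exact add_mul a b _

theorem leftMul_smul (c : ℂ) (b : B) (u : hk.PreSpace) :
    hk.leftMul (c • b) u = c • hk.leftMul b u := by
  refine Finsupp.ext (M := B) fun x => ?_
  exact smul_mul_assoc c b _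

theorem leftMul_one (u : hk.PreSpace) : hk.leftMul 1 u = u := by
  refine Finsupp.ext (M := B) fun x => ?_
  exact one_mul _

/-- Applying ‖b‖² − b*b = d*d to u gives ‖b‖²‖u‖² = ‖du‖² + ‖bu‖², so positivity alone yields
boundedness. -/
theorem norm_leftMul_le (b : B) (u : hk.PreSpace) : ‖hk.leftMul b u‖ ≤ ‖b‖ * ‖u‖ := by
  obtain ⟨d, hd⟩ := CStarAlgebra.exists_norm_sq_sub b
  have hd' : ((‖b‖ ^ 2 : ℝ) : ℂ) • (1 : B) = star d * d + star b * b := by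
    rw [← hd, sub_add_cancel, Algebra.algebraMap_eq_smul_one, Complex.coe_smul]
  have key : ((‖b‖ ^ 2 : ℝ) : ℂ) * ⟪u, u⟫_ℂ =
      ⟪hk.leftMul d u, hk.leftMul d u⟫_ℂ + ⟪hk.leftMul b u, hk.leftMul b u⟫_ℂ := by
    rw [hk.inner_leftMul_right, hk.inner_leftMul_right b, ← hk.leftMul_mul, ← hk.leftMul_mul,
      ← inner_add_left, ← hk.leftMul_add, ← hd', hk.leftMul_smul, hk.leftMul_one, inner_smul_left,
      Complex.conj_ofReal]
  simp only [inner_self_eq_norm_sq_to_K, RCLike.ofReal_eq_complex_ofReal] at key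
  have key' : ‖b‖ ^ 2 * ‖u‖ ^ 2 = ‖hk.leftMul d u‖ ^ 2 + ‖hk.leftMul b u‖ ^ 2 := by
    exact_mod_cast key
  refine abs_le_of_sq_le_sq' ?_ (by positivity) |>.2
  nlinarith [sq_nonneg ‖hk.leftMul d u‖]

/-- The Hilbert space of a positive definite kernel. -/
abbrev Space := UniformSpace.Completion hk.PreSpace

/-- Left multiplication as a bounded operator. -/
noncomputable def leftMulL (b : B) : hk.PreSpace →L[ℂ] hk.PreSpace :=
  (hk.leftMul b).mkContinuous ‖b‖ (hk.norm_leftMul_le b)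

/-- The bounded operator on the Hilbert space of a kernel given by left multiplication. -/
noncomputable def repL (b : B) : hk.Space →L[ℂ] hk.Space := (hk.leftMulL b).completion

theorem repL_coe (b : B) (u : hk.PreSpace) :
    hk.repL b (u : hk.Space) = (hk.leftMul b u : hk.PreSpace) :=
  (hk.leftMulL b).completion_apply_coe u

theorem ext_coe {T T' : hk.Space →L[ℂ] hk.Space}
    (h : ∀ u : hk.PreSpace, T (u : hk.Space) = T' (u : hk.Space)) : T = T' := by
  refine ContinuousLinearMap.ext fun c => ?_
  induction c using UniformSpace.Completion.induction_on with
  | hp => exact isClosed_eq T.continuous T'.continuous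
  | ih c => exact h c

theorem repL_add (a b : B) : hk.repL (a + b) = hk.repL a + hk.repL b :=
  hk.ext_coe fun u => by
    rw [add_apply, repL_coe, repL_coe, repL_coe, leftMul_add,
      UniformSpace.Completion.coe_add]

theorem repL_smul (c : ℂ) (b : B) : hk.repL (c • b) = c • hk.repL b :=
  hk.ext_coe fun u => by
    rw [smul_apply, repL_coe, repL_coe, leftMul_smul,
      UniformSpace.Completion.coe_smul]

theorem repL_mul (a b : B) : hk.repL (a * b) = hk.repL a * hk.repL b :=
  hk.ext_coe fun u => by
    rw [mul_apply_eq_comp, repL_coe, repL_coe, repL_coe, leftMul_mul]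

theorem repL_one : hk.repL 1 = 1 :=
  hk.ext_coe fun u => by
    rw [one_apply_eq_self, repL_coe, leftMul_one]

theorem repL_star (a : B) : hk.repL (star a) = star (hk.repL a) := by
  rw [ContinuousLinearMap.star_eq_adjoint]
  refine (ContinuousLinearMap.eq_adjoint_iff _ _).mpr fun x y => ?_
  induction x, y using UniformSpace.Completion.induction_on₂ with
  | hp => apply isClosed_eq <;> fun_prop
  | ih x y =>
    rw [repL_coe, repL_coe, UniformSpace.Completion.inner_coe, UniformSpace.Completion.inner_coe,
      inner_leftMul_right]

/-- The representation attached to a positive definite kernel. -/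
noncomputable def rep : B →⋆ₐ[ℂ] (hk.Space →L[ℂ] hk.Space) where
  toFun := hk.repL
  map_one' := hk.repL_one
  map_mul' := hk.repL_mul
  map_zero' := by simpa using hk.repL_smul 0 0
  map_add' := hk.repL_add
  commutes' r := by
    rw [Algebra.algebraMap_eq_smul_one, Algebra.algebraMap_eq_smul_one, repL_smul, repL_one]
  map_star' := hk.repL_star

@[simp] theorem rep_coe (b : B) (u : hk.PreSpace) :
    hk.rep b (u : hk.Space) = (hk.leftMul b u : hk.PreSpace) :=
  hk.repL_coe b u

/-- The vector attached to a point. -/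
noncomputable def vec (x : X) : hk.Space :=
  (hk.ofFinsupp (Finsupp.single x 1) : hk.PreSpace)

theorem rep_vec (b : B) (x : X) :
    hk.rep b (hk.vec x) = (hk.ofFinsupp (Finsupp.single x b) : hk.PreSpace) := by
  rw [vec, rep_coe]
  congr 1
  refine (Finsupp.mapRange_single (f := LinearMap.mulLeft ℂ b) (hf := by simp)).trans ?_
  exact congrArg (Finsupp.single x) (mul_one b)

theorem inner_vec (x y : X) (b : B) : ⟪hk.vec x, hk.rep b (hk.vec y)⟫_ℂ = k x y b := by
  rw [rep_vec, vec, UniformSpace.Completion.inner_coe]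
  change kernelForm k (Finsupp.single x 1) (Finsupp.single y b) = _
  rw [kernelForm]
  simp [hk.map_zero]

theorem dense_span_rep_vec :
    Dense (Submodule.span ℂ (Set.range fun p : B × X => hk.rep p.1 (hk.vec p.2)) :
      Set hk.Space) := by
  refine UniformSpace.Completion.denseRange_coe.mono ?_
  rintro _ ⟨u, rfl⟩
  refine Finsupp.induction_linear (motive := fun u : X →₀ B =>
    ((hk.ofFinsupp u : hk.PreSpace) : hk.Space) ∈
    (Submodule.span ℂ (Set.range fun p : B × X => hk.rep p.1 (hk.vec p.2)))) u ?_ ?_ ?_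
  · rw [_root_.map_zero, UniformSpace.Completion.coe_zero]
    exact Submodule.zero_mem _
  · intro f g hf hg
    rw [_root_.map_add, UniformSpace.Completion.coe_add]
    exact Submodule.add_mem _ hf hg
  · intro x b
    rw [← rep_vec]
    exact Submodule.subset_span ⟨(b, x), rfl⟩

end IsPosDefKernel

end KernelGNS

/-! ### Lexicographic maxima -/

/-- A compact set has a lexicographic maximum with respect to a well-ordered family of continuous
functions. -/
theorem IsCompact.exists_lex_max {X I : Type*} [TopologicalSpace X] [LinearOrder I]
    [WellFoundedLT I] {K : Set X} (hK : IsCompact K) (hne : K.Nonempty) {g : I → X → ℝ}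
    (hg : ∀ i, Continuous (g i)) :
    ∃ x ∈ K, ∀ y ∈ K, ∀ i, (∀ j < i, g j y = g j x) → g i y ≤ g i x := by
  classical
  -- The maximal values come from transfinite recursion: each c i is a supremum over the points that
  -- attain all earlier values.
  let c : I → ℝ := WellFounded.fix (r := (· < ·)) wellFounded_lt
    fun i c => sSup (g i '' {y ∈ K | ∀ j (hj : j < i), g j y = c j hj})
  have hc : ∀ i, c i = sSup (g i '' {y ∈ K | ∀ j < i, g j y = c j}) := fun i =>
    WellFounded.fix_eq _ _ i
  let G : I → Set X := fun i => ⋂ j : Set.Iic i, {y | g j y = c j}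
  have hGc : ∀ i, IsClosed (G i) := fun i =>
    isClosed_iInter fun j => isClosed_eq (hg j) continuous_const
  have hGanti : ∀ i j, i ≤ j → G j ⊆ G i := fun i j hij y hy => by
    simp only [G, Set.mem_iInter, Set.mem_ofPred_eq, Subtype.forall, Set.mem_Iic] at hy ⊢
    exact fun l hl => hy l (hl.trans hij)
  -- The sets G decrease, so a finite intersection is governed by its largest index; compactness
  -- covers limit stages.
  have hinter : ∀ J : Set I, (∀ j ∈ J, (K ∩ G j).Nonempty) → (K ∩ ⋂ j : J, G j).Nonempty := by
    intro J hJ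
    refine hK.inter_iInter_nonempty (fun j : J => G j) (fun j => hGc j) fun s => ?_
    rcases s.eq_empty_or_nonempty with rfl | hs
    · simpa using hne
    · obtain ⟨y, hyK, hy⟩ := hJ _ (s.max' hs).2
      refine ⟨y, hyK, ?_⟩
      simp only [Set.mem_iInter]
      exact fun j hj => hGanti _ _ (s.le_max' j hj) hy
  have hG : ∀ i, (K ∩ G i).Nonempty := by
    intro i
    induction i using WellFoundedLT.induction with
    | _ i ih =>
      obtain ⟨y, hyK, hy⟩ := hinter (Set.Iio i) ih
      have hF : {y ∈ K | ∀ j < i, g j y = c j} = K ∩ ⋂ j : Set.Iio i, {y | g j y = c j} := by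
        ext z; simp
      have hFc : IsCompact {y ∈ K | ∀ j < i, g j y = c j} := by
        rw [hF]
        exact hK.inter_right (isClosed_iInter fun j => isClosed_eq (hg j) continuous_const)
      have hFne : {y ∈ K | ∀ j < i, g j y = c j}.Nonempty := by
        refine ⟨y, hyK, fun j hj => ?_⟩
        simp only [G, Set.mem_iInter, Set.mem_ofPred_eq, Subtype.forall, Set.mem_Iic] at hy
        exact hy j hj j le_rfl
      obtain ⟨z, ⟨hzK, hz⟩, hzmax⟩ := (hFc.image (hg i)).sSup_mem (hFne.image _)
      refine ⟨z, hzK, ?_⟩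
      simp only [G, Set.mem_iInter, Set.mem_ofPred_eq, Subtype.forall, Set.mem_Iic]
      intro j hj
      rcases hj.lt_or_eq with hj | rfl
      · exact hz j hj
      · rw [hzmax, ← hc]
  obtain ⟨x, hxK, hx⟩ := hinter Set.univ fun j _ => hG j
  have hxc : ∀ i, g i x = c i := fun i => by
    simp only [G, Set.mem_iInter, Set.mem_ofPred_eq, Subtype.forall, Set.mem_Iic] at hx
    exact hx i trivial i le_rfl
  refine ⟨x, hxK, fun y hyK i hy => ?_⟩
  rw [hxc, hc]
  refine le_csSup ?_ ⟨y, ⟨hyK, fun j hj => (hy j hj).trans (hxc j)⟩, rfl⟩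
  exact ((hK.image (hg i)).bddAbove).mono (Set.image_mono fun z hz => hz.1)

/-- Equality with a lexicographic maximum, given that every value is at least the maximal one
whenever all the earlier values agree. -/
theorem eq_of_lex_max {X I : Type*} [LinearOrder I] [WellFoundedLT I] {K : Set X} {g : I → X → ℝ}
    {x y : X} (hx : ∀ y ∈ K, ∀ i, (∀ j < i, g j y = g j x) → g i y ≤ g i x) (hy : y ∈ K)
    (h : ∀ i, (∀ j < i, g j y = g j x) → g i x ≤ g i y) (i : I) : g i y = g i x := by
  induction i using WellFoundedLT.induction with
  | _ i ih => exact le_antisymm (hx y hy i ih) (h i ih)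

/-- A lexicographic maximum is extreme with respect to the values of the family. -/
theorem eq_of_lex_max_of_convex {X I : Type*} [LinearOrder I] [WellFoundedLT I] {K : Set X}
    {g : I → X → ℝ} {x y z : X}
    (hx : ∀ y ∈ K, ∀ i, (∀ j < i, g j y = g j x) → g i y ≤ g i x) (hy : y ∈ K) (hz : z ∈ K)
    {t : ℝ} (ht0 : 0 < t) (ht1 : t < 1) (h : ∀ i, g i x = t * g i y + (1 - t) * g i z) (i : I) :
    g i y = g i x := by
  suffices H : g i y = g i x ∧ g i z = g i x from H.1
  induction i using WellFoundedLT.induction with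
  | _ i ih =>
    have h1 := hx y hy i fun j hj => (ih j hj).1
    have h2 := hx z hz i fun j hj => (ih j hj).2
    have h3 := h i
    constructor <;> nlinarith

/-! ### Moment kernels of words -/

section Words

variable {B : Type*} [CStarAlgebra B] {E ι : Type*} (e : E → B)

/-- Words in the letters `E` applied to generators indexed by `ι`. -/
abbrev GenWord (E ι : Type*) := List E × ι

variable {L : Type*} [NormedAddCommGroup L] [InnerProductSpace ℂ L] [CompleteSpace L]

/-- The vector obtained by applying a word, letter by letter, to a family of vectors. -/
noncomputable def wordVec (θ : B →⋆ₐ[ℂ] (L →L[ℂ] L)) (η : ι → L) : List E → ι → L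
  | [], i => η i
  | s :: l, i => θ (e s) (wordVec θ η l i)

/-- The kernel of moments of a family of vectors. -/
noncomputable def momentKernel (θ : B →⋆ₐ[ℂ] (L →L[ℂ] L)) (η : ι → L) :
    GenWord E ι → GenWord E ι → B → ℂ :=
  fun w w' b => ⟪wordVec e θ η w.1 w.2, θ b (wordVec e θ η w'.1 w'.2)⟫_ℂ

/-- The set of kernels that generalizes the moments of a family of vectors of total norm one. -/
structure IsMomentKernel [Fintype ι] (k : GenWord E ι → GenWord E ι → B → ℂ) : Prop
    extends IsPosDefKernel k where
  shift : ∀ w s l i, k w (s :: l, i) 1 = k w (l, i) (e s)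
  trace_one : ∑ i, k ([], i) ([], i) 1 = 1
  bound : ∀ w w' b,
    ‖k w w' b‖ ≤ ‖b‖ * (w.1.map fun s => ‖e s‖).prod * (w'.1.map fun s => ‖e s‖).prod

theorem kernelForm_of_vec {X : Type*} (θ : B →⋆ₐ[ℂ] (L →L[ℂ] L)) (ξ : X → L) (u v : X →₀ B) :
    kernelForm (fun x y b => ⟪ξ x, θ b (ξ y)⟫_ℂ) u v =
      ⟪u.sum fun x a => θ a (ξ x), v.sum fun x a => θ a (ξ x)⟫_ℂ := by
  unfold kernelForm
  rw [Finsupp.sum_inner]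
  refine Finsupp.sum_congr fun x _ => ?_
  rw [Finsupp.inner_sum]
  refine Finsupp.sum_congr fun y _ => ?_
  beta_reduce
  rw [map_mul, map_star, mul_apply_eq_comp, ContinuousLinearMap.star_eq_adjoint,
    ContinuousLinearMap.adjoint_inner_right]

theorem isPosDefKernel_of_vec {X : Type*} (θ : B →⋆ₐ[ℂ] (L →L[ℂ] L)) (ξ : X → L) :
    IsPosDefKernel fun x y b => ⟪ξ x, θ b (ξ y)⟫_ℂ where
  map_add x y a b := by simp
  map_smul x y c a := by simp
  map_star x y a := by
    rw [map_star, ContinuousLinearMap.star_eq_adjoint, ContinuousLinearMap.adjoint_inner_right,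
      ← inner_conj_symm]
    rfl
  nonneg u := by
    rw [kernelForm_of_vec]
    exact inner_self_nonneg (𝕜 := ℂ)

theorem norm_rep_apply_le (θ : B →⋆ₐ[ℂ] (L →L[ℂ] L)) (b : B) (x : L) : ‖θ b x‖ ≤ ‖b‖ * ‖x‖ :=
  (ContinuousLinearMap.le_opNorm _ _).trans
    (mul_le_mul_of_nonneg_right (NonUnitalStarAlgHom.norm_apply_le θ b) (norm_nonneg x))

theorem norm_wordVec_le (θ : B →⋆ₐ[ℂ] (L →L[ℂ] L)) {η : ι → L} {i : ι} (hη : ‖η i‖ ≤ 1)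
    (l : List E) : ‖wordVec e θ η l i‖ ≤ (l.map fun s => ‖e s‖).prod := by
  induction l with
  | nil => simpa [wordVec] using hη
  | cons s l ih =>
    simp only [wordVec, List.map_cons, List.prod_cons]
    exact (norm_rep_apply_le θ _ _).trans (mul_le_mul_of_nonneg_left ih (norm_nonneg _))

theorem isMomentKernel_momentKernel [Fintype ι] (θ : B →⋆ₐ[ℂ] (L →L[ℂ] L)) {η : ι → L}
    (hη : ∑ i, ‖η i‖ ^ 2 = 1) : IsMomentKernel e (momentKernel e θ η) where
  toIsPosDefKernel := isPosDefKernel_of_vec θ fun w : GenWord E ι => wordVec e θ η w.1 w.2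
  shift w s l i := by simp [momentKernel, wordVec]
  trace_one := by
    simp only [momentKernel, wordVec, map_one, one_apply_eq_self, inner_self_eq_norm_sq_to_K,
      RCLike.ofReal_eq_complex_ofReal]
    exact_mod_cast hη
  bound w w' b := by
    have h1 : ∀ i, ‖η i‖ ≤ 1 := fun i => by
      have := Finset.single_le_sum (f := fun i => ‖η i‖ ^ 2) (fun j _ => sq_nonneg _)
        (Finset.mem_univ i)
      rw [hη] at this
      exact (sq_le_one_iff₀ (norm_nonneg _)).mp this
    have hw := norm_wordVec_le e θ (h1 w.2) w.1
    have hw' := norm_wordVec_le e θ (h1 w'.2) w'.1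
    have hw0 := (norm_nonneg _).trans hw
    calc ‖momentKernel e θ η w w' b‖
        ≤ ‖wordVec e θ η w.1 w.2‖ * ‖θ b (wordVec e θ η w'.1 w'.2)‖ := norm_inner_le_norm _ _
      _ ≤ ‖wordVec e θ η w.1 w.2‖ * (‖b‖ * ‖wordVec e θ η w'.1 w'.2‖) := by
          gcongr; exact norm_rep_apply_le θ _ _
      _ = ‖b‖ * ‖wordVec e θ η w.1 w.2‖ * ‖wordVec e θ η w'.1 w'.2‖ := by ring
      _ ≤ _ := by gcongr

/-- The norm bounds place the kernels in a product of discs, compact by Tychonoff. Every other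
condition involves finitely many values at a time, hence is closed. -/
theorem isCompact_setOf_isMomentKernel [Fintype ι] :
    IsCompact {k : GenWord E ι → GenWord E ι → B → ℂ | IsMomentKernel e k} := by
  have hc : IsCompact (Set.univ.pi fun w : GenWord E ι => Set.univ.pi fun w' : GenWord E ι =>
      Set.univ.pi fun b : B => Metric.closedBall (0 : ℂ)
        (‖b‖ * (w.1.map fun s => ‖e s‖).prod * (w'.1.map fun s => ‖e s‖).prod)) :=
    isCompact_univ_pi fun w => isCompact_univ_pi fun w' => isCompact_univ_pi fun b =>
      isCompact_closedBall _ _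
  refine hc.of_isClosed_subset ?_ fun k hk => ?_
  · have : {k : GenWord E ι → GenWord E ι → B → ℂ | IsMomentKernel e k} =
        {k | ∀ x y a b, k x y (a + b) = k x y a + k x y b} ∩
        {k | ∀ x y (c : ℂ) a, k x y (c • a) = c * k x y a} ∩
        {k | ∀ x y a, k y x (star a) = star (k x y a)} ∩
        {k | ∀ u, 0 ≤ (kernelForm k u u).re} ∩
        {k | ∀ w s l i, k w (s :: l, i) 1 = k w (l, i) (e s)} ∩
        {k | ∑ i, k ([], i) ([], i) 1 = 1} ∩
        {k | ∀ w w' b, ‖k w w' b‖ ≤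
          ‖b‖ * (w.1.map fun s => ‖e s‖).prod * (w'.1.map fun s => ‖e s‖).prod} := by
      ext k
      exact ⟨fun h => ⟨⟨⟨⟨⟨⟨h.map_add, h.map_smul⟩, h.map_star⟩, h.nonneg⟩, h.shift⟩,
        h.trace_one⟩, h.bound⟩, fun ⟨⟨⟨⟨⟨⟨h1, h2⟩, h3⟩, h4⟩, h5⟩, h6⟩, h7⟩ =>
        ⟨⟨h1, h2, h3, h4⟩, h5, h6, h7⟩⟩
    rw [this]
    simp only [Set.ofPred_forall, kernelForm, Finsupp.sum]
    refine IsClosed.inter (IsClosed.inter (IsClosed.inter (IsClosed.inter (IsClosed.inter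
      (IsClosed.inter ?_ ?_) ?_) ?_) ?_) ?_) ?_
    · exact isClosed_iInter fun x => isClosed_iInter fun y => isClosed_iInter fun a =>
        isClosed_iInter fun b => isClosed_eq (by fun_prop) (by fun_prop)
    · exact isClosed_iInter fun x => isClosed_iInter fun y => isClosed_iInter fun a =>
        isClosed_iInter fun b => isClosed_eq (by fun_prop) (by fun_prop)
    · exact isClosed_iInter fun x => isClosed_iInter fun y => isClosed_iInter fun a =>
        isClosed_eq (by fun_prop) (by fun_prop)
    · exact isClosed_iInter fun u => isClosed_le (by fun_prop)
        (Complex.continuous_re.comp (by fun_prop))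
    · exact isClosed_iInter fun x => isClosed_iInter fun y => isClosed_iInter fun a =>
        isClosed_iInter fun b => isClosed_eq (by fun_prop) (by fun_prop)
    · exact isClosed_eq (by fun_prop) (by fun_prop)
    · exact isClosed_iInter fun x => isClosed_iInter fun y => isClosed_iInter fun a =>
        isClosed_le (by fun_prop) (by fun_prop)
  · simp only [Set.mem_pi, Set.mem_univ, true_implies, mem_closedBall_zero_iff]
    exact hk.bound

end Words

/-- Here y − x is orthogonal to x, so y is longer than x unless the two are equal. -/
theorem eq_of_inner_eq_of_norm_le {L : Type*} [NormedAddCommGroup L] [InnerProductSpace ℂ L]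
    {x y : L} (h : ⟪x, y⟫_ℂ = ⟪x, x⟫_ℂ)
    (hn : ‖y‖ ≤ ‖x‖) : y = x := by
  have h1 : RCLike.re ⟪x, y⟫_ℂ = ‖x‖ ^ 2 := by rw [h, inner_self_eq_norm_sq]
  have h2 := norm_sub_sq (𝕜 := ℂ) x y
  rw [h1] at h2
  have h3 : ‖x - y‖ ^ 2 ≤ 0 := by nlinarith [norm_nonneg x, norm_nonneg y]
  have h4 : ‖x - y‖ = 0 := by
    exact pow_eq_zero_iff (two_ne_zero) |>.mp (le_antisymm h3 (sq_nonneg _))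
  exact (sub_eq_zero.mp (norm_eq_zero.mp h4)).symm

/-! ### Lexicographically maximal kernels and rigidity -/

section LexMax

variable {B : Type*} [CStarAlgebra B] {E ι : Type*} (e : E → B)

/-- Linear combinations of words, as an index type for a well-ordered family. -/
def WordComb (E ι : Type*) := GenWord E ι →₀ ℂ

/-- Any well-order will do: rigidity compares a combination only with words of smaller length. -/
noncomputable instance : LinearOrder (WordComb E ι) := by
  classical exact linearOrderOfSTO WellOrderingRel

instance : WellFoundedLT (WordComb E ι) :=
  ⟨(inferInstance : IsWellFounded (WordComb E ι) WellOrderingRel).wf⟩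

/-- The length of the longest word in a linear combination. -/
def wordDegree (v : GenWord E ι →₀ ℂ) : ℕ := v.support.sup fun w => w.1.length

/-- The quadratic form of a kernel on linear combinations of words. -/
noncomputable def quad (k : GenWord E ι → GenWord E ι → B → ℂ) (v : GenWord E ι →₀ ℂ) : ℝ :=
  (v.sum fun w a => v.sum fun w' a' => star a * a' * k w w' 1).re

theorem quad_eq_norm_sq {L : Type*} [NormedAddCommGroup L] [InnerProductSpace ℂ L]
    {k : GenWord E ι → GenWord E ι → B → ℂ} {ξ : GenWord E ι → L}
    (h : ∀ w w', ⟪ξ w, ξ w'⟫_ℂ = k w w' 1) (v : GenWord E ι →₀ ℂ) :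
    quad k v = ‖Finsupp.linearCombination ℂ ξ v‖ ^ 2 := by
  rw [← inner_self_eq_norm_sq (𝕜 := ℂ), Finsupp.linearCombination_apply, Finsupp.sum_inner, quad]
  congr 1
  refine Finsupp.sum_congr fun w _ => ?_
  rw [Finsupp.inner_sum]
  refine Finsupp.sum_congr fun w' _ => ?_
  rw [inner_smul_left, inner_smul_right, h, ← mul_assoc]
  rfl

theorem continuous_quad (v : GenWord E ι →₀ ℂ) :
    Continuous fun k : GenWord E ι → GenWord E ι → B → ℂ => quad k v := by
  unfold quad Finsupp.sum
  exact Complex.continuous_re.comp (by fun_prop)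

variable [Fintype ι]

/-- The linear combination of words given by a row of a matrix. -/
noncomputable def matrixRow (m : ι → ι → E) (i : ι) : GenWord E ι →₀ ℂ :=
  ∑ j, Finsupp.single ([m i j], j) 1

theorem linearCombination_matrixRow {L : Type*} [NormedAddCommGroup L] [InnerProductSpace ℂ L]
    (ξ : GenWord E ι → L) (m : ι → ι → E) (i : ι) :
    Finsupp.linearCombination ℂ ξ (matrixRow m i) = ∑ j, ξ ([m i j], j) := by
  simp [matrixRow]

/-- The family of functions of a kernel that is maximized lexicographically: first the total
norm of a matrix applied to the generators, then the norms of all linear combinations of words,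
by increasing length. -/
noncomputable def lexFamily (m : ι → ι → E) (i : ℕ ×ₗ WordComb E ι)
    (k : GenWord E ι → GenWord E ι → B → ℂ) : ℝ :=
  match ofLex i with
  | (0, _) => ∑ i, quad k (matrixRow m i)
  | (d + 1, v) => if wordDegree (E := E) (ι := ι) v ≤ d then quad k v else 0

theorem lexFamily_zero (m : ι → ι → E) (v : WordComb E ι)
    (k : GenWord E ι → GenWord E ι → B → ℂ) :
    lexFamily m (toLex (0, v)) k = ∑ i, quad k (matrixRow m i) := rfl

theorem lexFamily_succ (m : ι → ι → E) (d : ℕ) (v : WordComb E ι)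
    (k : GenWord E ι → GenWord E ι → B → ℂ) :
    lexFamily m (toLex (d + 1, v)) k =
      if wordDegree (E := E) (ι := ι) v ≤ d then quad k v else 0 := rfl

theorem quad_eq_of_lexFamily_eq {m : ι → ι → E} {d : ℕ} {v : GenWord E ι →₀ ℂ}
    {k k' : GenWord E ι → GenWord E ι → B → ℂ} (hv : wordDegree v ≤ d)
    (h : lexFamily m (@toLex (ℕ × WordComb E ι) (d + 1, v)) k =
      lexFamily m (@toLex (ℕ × WordComb E ι) (d + 1, v)) k') : quad k v = quad k' v := by
  have h' : (if wordDegree v ≤ d then quad k v else 0) =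
    if wordDegree v ≤ d then quad k' v else 0 := h
  rwa [if_pos hv, if_pos hv] at h'

theorem continuous_lexFamily (m : ι → ι → E) (i : ℕ ×ₗ WordComb E ι) :
    Continuous (lexFamily (B := B) m i) := by
  obtain ⟨⟨d, v⟩, rfl⟩ := toLex.surjective i
  rcases d with _ | d
  · exact continuous_finsetSum _ fun i _ => continuous_quad _
  · change Continuous fun k => if wordDegree (E := E) (ι := ι) v ≤ d then quad k v else 0
    split_ifs
    · exact continuous_quad _
    · exact continuous_const

/-- A moment kernel that is lexicographically maximal. -/
structure IsLexMaxKernel (m : ι → ι → E) (k : GenWord E ι → GenWord E ι → B → ℂ) : Prop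
    extends IsMomentKernel e k where
  lex_max : ∀ y ∈ {y | IsMomentKernel e y}, ∀ i,
    (∀ j < i, lexFamily m j y = lexFamily m j k) → lexFamily m i y ≤ lexFamily m i k

/-- There is a lexicographically maximal moment kernel, and it maximizes the first function. -/
theorem exists_isLexMaxKernel (m : ι → ι → E) {k₀ : GenWord E ι → GenWord E ι → B → ℂ}
    (hk₀ : IsMomentKernel e k₀) :
    ∃ k, IsLexMaxKernel e m k ∧
      ∑ i, quad k₀ (matrixRow m i) ≤ ∑ i, quad k (matrixRow m i) := by
  obtain ⟨k, hk, hmax⟩ := (isCompact_setOf_isMomentKernel e).exists_lex_max ⟨k₀, hk₀⟩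
    (continuous_lexFamily (B := B) m)
  refine ⟨k, ⟨hk, hmax⟩, ?_⟩
  -- With v least, no index precedes (0, v), so maximality there carries no condition.
  obtain ⟨v, hv⟩ := WellFounded.has_min (r := ((· < ·) : WordComb E ι → WordComb E ι → Prop))
    wellFounded_lt Set.univ ⟨(0 : GenWord E ι →₀ ℂ), trivial⟩
  refine hmax k₀ hk₀ (toLex (0, v)) fun j hj => ?_
  obtain ⟨⟨d, w⟩, rfl⟩ := toLex.surjective j
  rw [Prod.Lex.toLex_lt_toLex] at hj
  exact absurd hj (by simpa using fun _ => hv.2 w trivial)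

section Rigidity

variable {e} {m : ι → ι → E} {k : GenWord E ι → GenWord E ι → B → ℂ}
  {L : Type*} [NormedAddCommGroup L] [InnerProductSpace ℂ L] [CompleteSpace L]

/-- Vectors in a dilation of a lexicographically maximal kernel are moved by the letters in the
same way as the words. -/
theorem IsLexMaxKernel.eq_wordVec (hk : IsLexMaxKernel e m k) (θ : B →⋆ₐ[ℂ] (L →L[ℂ] L))
    {ζ : GenWord E ι → L} (h1 : ∀ w w', ⟪ζ w, ζ w'⟫_ℂ = k w w' 1)
    (h2 : ∀ w l i s, ⟪ζ w, θ (e s) (ζ (l, i))⟫_ℂ = k w (l, i) (e s)) (l : List E) (i : ι) :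
    wordVec e θ (fun i => ζ ([], i)) l i = ζ (l, i) := by
  classical
  set η : ι → L := fun i => ζ ([], i) with hη
  set ξ : GenWord E ι → L := fun w => wordVec e θ η w.1 w.2 with hξ
  have hη1 : ∑ i, ‖η i‖ ^ 2 = 1 := by
    have := hk.trace_one
    simp only [← h1, inner_self_eq_norm_sq_to_K, RCLike.ofReal_eq_complex_ofReal] at this
    exact_mod_cast this
  have hk' : IsMomentKernel e (momentKernel e θ η) := isMomentKernel_momentKernel e θ hη1
  have hgram : ∀ w w', ⟪ξ w, ξ w'⟫_ℂ = momentKernel e θ η w w' 1 := fun w w' => by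
    simp [momentKernel, hξ]
  have hnil : ∀ u i, ⟪ζ u, ξ ([], i)⟫_ℂ = ⟪ζ u, ζ ([], i)⟫_ℂ := fun u i => rfl
  have hcons : ∀ s l i, ξ (l, i) = ζ (l, i) →
      ∀ u, ⟪ζ u, ξ (s :: l, i)⟫_ℂ = ⟪ζ u, ζ (s :: l, i)⟫_ℂ := by
    intro s l i h u
    have : ξ (s :: l, i) = θ (e s) (ξ (l, i)) := rfl
    rw [this, h, h2, h1, hk.shift]
  -- If ξ_w projects onto ζ_w for each word of v, then the ζ-combination is the projection of the
  -- ξ-combination, hence no longer.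
  have hle : ∀ v : GenWord E ι →₀ ℂ, (∀ w ∈ v.support, ∀ u, ⟪ζ u, ξ w⟫_ℂ = ⟪ζ u, ζ w⟫_ℂ) →
      quad k v ≤ quad (momentKernel e θ η) v := by
    intro v hv
    rw [quad_eq_norm_sq h1, quad_eq_norm_sq hgram]
    have key : ⟪Finsupp.linearCombination ℂ ζ v, Finsupp.linearCombination ℂ ξ v⟫_ℂ =
        ⟪Finsupp.linearCombination ℂ ζ v, Finsupp.linearCombination ℂ ζ v⟫_ℂ := by
      rw [Finsupp.linearCombination_apply ℂ (v := ξ), Finsupp.linearCombination_apply ℂ (v := ζ),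
        Finsupp.sum_inner, Finsupp.sum_inner]
      refine Finsupp.sum_congr fun w _ => ?_
      rw [Finsupp.inner_sum, Finsupp.inner_sum]
      refine Finsupp.sum_congr fun w' hw' => ?_
      simp only [inner_smul_left, inner_smul_right, hv w' hw']
    by_contra! hlt
    have hn := abs_le_of_sq_le_sq' hlt.le (norm_nonneg _) |>.2
    rw [eq_of_inner_eq_of_norm_le key hn] at hlt
    exact lt_irrefl _ hlt
  have hagree : ∀ d, (∀ d' ≤ d, ∀ v, lexFamily m (toLex (d', v)) (momentKernel e θ η) =
      lexFamily m (toLex (d', v)) k) → ∀ l, l.length < d → ∀ i, ξ (l, i) = ζ (l, i) := by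
    intro d hd l
    induction l with
    | nil => exact fun _ i => rfl
    | cons s l ih =>
      intro hl i
      rw [List.length_cons] at hl
      have hdeg : wordDegree (Finsupp.single (s :: l, i) 1 : GenWord E ι →₀ ℂ) ≤
          l.length + 1 := by
        refine Finset.sup_le fun w hw => ?_
        have := Finset.mem_singleton.mp (Finsupp.support_single_subset hw)
        simp [this]
      -- Level d + 1 tests words of length at most d, so the word s :: l is tested at level
      -- `l.length + 2`.
      have hg := quad_eq_of_lexFamily_eq hdeg (hd (l.length + 1 + 1) hl _)
      rw [quad_eq_norm_sq h1, quad_eq_norm_sq hgram] at hg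
      simp only [Finsupp.linearCombination_single, one_smul] at hg
      refine eq_of_inner_eq_of_norm_le (hcons s l i (ih (by omega) i) _) ?_
      exact (abs_le_of_sq_le_sq' hg.le (norm_nonneg _)).2
  have hall : ∀ j, lexFamily m j (momentKernel e θ η) = lexFamily m j k := by
    refine eq_of_lex_max hk.lex_max hk' fun j hj => ?_
    obtain ⟨⟨d, v⟩, rfl⟩ := toLex.surjective j
    rcases d with _ | d
    · rw [lexFamily_zero, lexFamily_zero]
      -- Level 0 involves only one-letter words, and the empty words agree by definition, so nothing
      -- earlier is needed.
      refine Finset.sum_le_sum fun i _ => hle _ fun w hw u => ?_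
      have hw' := Finsupp.support_finsetSum hw
      simp only [Finset.mem_biUnion, Finset.mem_univ, true_and] at hw'
      obtain ⟨j, hj⟩ := hw'
      rw [Finset.mem_singleton.mp (Finsupp.support_single_subset hj)]
      exact hcons _ _ _ rfl u
    · rw [lexFamily_succ, lexFamily_succ]
      split_ifs with hdeg
      · have hd := hagree d fun d' hd' v' => hj _ (by
          rw [Prod.Lex.toLex_lt_toLex]
          exact Or.inl (Nat.lt_succ_of_le hd'))
        refine hle _ fun w hw u => ?_
        have hwl : w.1.length ≤ d := (Finset.le_sup (f := fun w => w.1.length) hw).trans hdeg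
        obtain ⟨l, i⟩ := w
        rcases l with _ | ⟨s, l⟩
        · exact hnil u i
        · exact hcons s l i (hd l hwl i) u
      · exact le_rfl
  exact hagree (l.length + 1) (fun d' _ v => hall _) l (Nat.lt_succ_self _) i

end Rigidity

end LexMax

/-! ### Positive operator matrices and Stinespring kernels -/

section Positivity

theorem CStarAlgebra.exists_eq_star_mul_self {D : Type*} [CStarAlgebra D] [PartialOrder D]
    [StarOrderedRing D] {a : D} (ha : 0 ≤ a) : ∃ r, a = star r * r :=
  CStarAlgebra.nonneg_iff_eq_star_mul_self.mp ha

variable {L : Type*} [NormedAddCommGroup L] [InnerProductSpace ℂ L] [CompleteSpace L]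
  {ι : Type*} [Fintype ι]

theorem CStarMatrix.sum_inner_star_mul (R T : CStarMatrix ι ι (L →L[ℂ] L)) (x y : ι → L) :
    ∑ i, ∑ j, ⟪x i, (star R * T) i j (y j)⟫_ℂ =
      ∑ l, ⟪∑ i, R l i (x i), ∑ j, T l j (y j)⟫_ℂ := by
  simp only [CStarMatrix.mul_apply, CStarMatrix.star_apply, sum_apply,
    inner_sum, mul_apply_eq_comp, ContinuousLinearMap.star_eq_adjoint,
    ContinuousLinearMap.adjoint_inner_right]
  simp only [sum_inner]
  rw [Finset.sum_comm]
  simp only [Finset.sum_comm (s := Finset.univ) (t := Finset.univ) (f := fun i l =>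
    ⟪(R l i) (x i), (T l _) (y _)⟫_ℂ)]
  rw [Finset.sum_comm]

theorem CStarMatrix.re_sum_inner_nonneg {N : CStarMatrix ι ι (L →L[ℂ] L)} (hN : 0 ≤ N)
    (x : ι → L) : 0 ≤ (∑ i, ∑ j, ⟪x i, N i j (x j)⟫_ℂ).re := by
  classical
  obtain ⟨R, rfl⟩ := CStarAlgebra.exists_eq_star_mul_self hN
  rw [CStarMatrix.sum_inner_star_mul, Complex.re_sum]
  exact Finset.sum_nonneg fun l _ => inner_self_nonneg (𝕜 := ℂ)

/-- Evaluating ‖N‖²·1 − N*N = d*d at x gives the operator bound without identifying matrices over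
B(L) with operators on a direct sum. -/
theorem CStarMatrix.sum_norm_sq_le (N : CStarMatrix ι ι (L →L[ℂ] L)) (x : ι → L) :
    ∑ i, ‖∑ j, N i j (x j)‖ ^ 2 ≤ ‖N‖ ^ 2 * ∑ i, ‖x i‖ ^ 2 := by
  classical
  obtain ⟨d, hd⟩ := CStarAlgebra.exists_norm_sq_sub N
  have hd' : ((‖N‖ ^ 2 : ℝ) : ℂ) • (star 1 * 1 : CStarMatrix ι ι (L →L[ℂ] L)) =
      star d * d + star N * N := by
    rw [← hd, sub_add_cancel, Algebra.algebraMap_eq_smul_one, Complex.coe_smul, star_one, one_mul]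
  have h : ((‖N‖ ^ 2 : ℝ) : ℂ) *
      ∑ i, ∑ j, ⟪x i, (star 1 * 1 : CStarMatrix ι ι (L →L[ℂ] L)) i j (x j)⟫_ℂ =
      ∑ i, ∑ j, ⟪x i, (star d * d) i j (x j)⟫_ℂ + ∑ i, ∑ j, ⟪x i, (star N * N) i j (x j)⟫_ℂ := by
    simp only [← Finset.sum_add_distrib, Finset.mul_sum]
    refine Finset.sum_congr rfl fun i _ => Finset.sum_congr rfl fun j _ => ?_
    have he := CStarMatrix.ext_iff.mpr hd' i j
    rw [CStarMatrix.smul_apply, CStarMatrix.add_apply] at he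
    have he' : ((‖N‖ ^ 2 : ℝ) : ℂ) • (star 1 * 1 : CStarMatrix ι ι (L →L[ℂ] L)) i j (x j) =
        (star d * d) i j (x j) + (star N * N) i j (x j) := DFunLike.congr_fun he (x j)
    rw [← inner_smul_right, he', inner_add_right]
  simp only [CStarMatrix.sum_inner_star_mul, inner_self_eq_norm_sq_to_K,
    RCLike.ofReal_eq_complex_ofReal] at h
  have h1 : ∀ i, ∑ j, (1 : CStarMatrix ι ι (L →L[ℂ] L)) i j (x j) = x i := fun i => by
    rw [Finset.sum_eq_single i]
    · simp
    · intro j _ hj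
      simp [hj.symm]
    · simp
  simp only [h1] at h
  have h2 : ‖N‖ ^ 2 * ∑ i, ‖x i‖ ^ 2 =
      ∑ i, ‖∑ j, d i j (x j)‖ ^ 2 + ∑ i, ‖∑ j, N i j (x j)‖ ^ 2 := by exact_mod_cast h
  rw [h2]
  exact le_add_of_nonneg_left (Finset.sum_nonneg fun i _ => sq_nonneg _)

variable {B : Type*} [CStarAlgebra B] [PartialOrder B] [StarOrderedRing B]

/-- This is Stinespring's theorem in kernel form: the index set is L itself, and
`IsPosDefKernel.vec` maps L to the dilation space. -/
theorem CompletelyPositiveMap.isPosDefKernel (ψ : B →CP (L →L[ℂ] L)) :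
    IsPosDefKernel fun x y b => ⟪x, ψ b y⟫_ℂ where
  map_add x y a b := by simp
  map_smul x y c a := by simp
  map_star x y a := by
    have h : ψ (star a) = star (ψ a) := map_star ψ a
    rw [h, ContinuousLinearMap.star_eq_adjoint, ContinuousLinearMap.adjoint_inner_right,
      ← inner_conj_symm]
    rfl
  nonneg u := by
    classical
    rcases u.support.eq_empty_or_nonempty with h0 | hne
    · simp [kernelForm, Finsupp.sum, h0]
    -- All rows of R equal u, so R*R is the matrix of the products u_i* u_j multiplied by the number
    -- of rows, a positive factor cancelled below.
    let R : CStarMatrix u.support u.support B := CStarMatrix.ofMatrix fun _ y => u y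
    have hR := ψ.map_cstarMatrix_nonneg (star R * R) (star_mul_self_nonneg R)
    have hp := CStarMatrix.re_sum_inner_nonneg hR (fun x : u.support => (x : L))
    have hentry : ∀ i j, (star R * R) i j = (u.support.card : ℂ) • (star (u i) * u j) := by
      intro i j
      rw [CStarMatrix.mul_apply]
      change ∑ l : u.support, star (u i) * u j = _
      rw [Finset.sum_const, Finset.card_univ, Fintype.card_coe, Nat.cast_smul_eq_nsmul]
    simp only [CStarMatrix.map_apply, hentry, map_smul, smul_apply, inner_smul_right,
      ← Finset.mul_sum] at hp
    rw [← Complex.ofReal_natCast, Complex.re_ofReal_mul] at hp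
    have hc : (0 : ℝ) < u.support.card := by exact_mod_cast hne.card_pos
    refine (nonneg_of_mul_nonneg_right hp hc).trans_eq ?_
    unfold kernelForm Finsupp.sum
    congr 1
    rw [← Finset.sum_coe_sort u.support fun x => ∑ y ∈ u.support, ⟪x, ψ (star (u x) * u y) y⟫_ℂ]
    exact Finset.sum_congr rfl fun x _ => Finset.sum_coe_sort u.support fun y =>
      ⟪(x : L), ψ (star (u x) * u y) y⟫_ℂ

end Positivity

/-! ### Invariant subspaces reduce -/

section ProjectionCommute

variable {B : Type*} [CStarAlgebra B] {L : Type*} [NormedAddCommGroup L] [InnerProductSpace ℂ L]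
  [CompleteSpace L] {π : B →⋆ₐ[ℂ] (L →L[ℂ] L)} {K : Submodule ℂ L}

theorem orthogonal_invariant_of_invariant (hK : ∀ b, ∀ x ∈ K, π b x ∈ K) (b : B) :
    ∀ x ∈ Kᗮ, π b x ∈ Kᗮ := by
  intro x hx y hy
  rw [← ContinuousLinearMap.adjoint_inner_left, ← ContinuousLinearMap.star_eq_adjoint, ← map_star]
  exact hx _ (hK _ y hy)

theorem starProjection_commute_of_invariant [K.HasOrthogonalProjection]
    (hK : ∀ b, ∀ x ∈ K, π b x ∈ K) (b : B) (x : L) :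
    K.starProjection (π b x) = π b (K.starProjection x) := by
  refine Submodule.eq_starProjection_of_mem_orthogonal (hK _ _ (K.starProjection_apply_mem x)) ?_
  rw [← map_sub]
  exact orthogonal_invariant_of_invariant hK b _ (K.sub_starProjection_mem_orthogonal x)

end ProjectionCommute

/-! ### Passing from products of letters to the whole algebra -/

section Words

variable {B : Type*} [CStarAlgebra B] {E ι : Type*} (e : E → B)
  {L : Type*} [NormedAddCommGroup L] [InnerProductSpace ℂ L] [CompleteSpace L]

theorem wordVec_map (θ : B →⋆ₐ[ℂ] (L →L[ℂ] L)) (η : ι → L) (T : L →L[ℂ] L)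
    (hT : ∀ b x, T (θ b x) = θ b (T x)) (l : List E) (i : ι) :
    wordVec e θ (fun i => T (η i)) l i = T (wordVec e θ η l i) := by
  induction l with
  | nil => rfl
  | cons s l ih => rw [wordVec, wordVec, ih, hT]

theorem mem_of_generators {F : Type*} [NormedAddCommGroup F] [NormedSpace ℂ F]
    (hgen : Dense (Submodule.span ℂ (Submonoid.closure (Set.range e) : Set B) : Set B))
    (f : B →ₗ[ℂ] F) (hf : Continuous f) (N : Submodule ℂ F) (hN : IsClosed (N : Set F))
    (h : ∀ b ∈ Submonoid.closure (Set.range e), f b ∈ N) (b : B) : f b ∈ N := by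
  have h1 : Submodule.span ℂ (Submonoid.closure (Set.range e) : Set B) ≤ N.comap f :=
    Submodule.span_le.mpr h
  have h2 : IsClosed (N.comap f : Set B) := hN.preimage hf
  exact h2.closure_subset_iff.mpr h1 (hgen b)

theorem continuous_starAlgHom_apply (θ : B →⋆ₐ[ℂ] (L →L[ℂ] L)) (x : L) :
    Continuous fun b => θ b x := by
  have : Continuous θ := map_continuous θ
  fun_prop

theorem inner_eq_of_generators
    (hgen : Dense (Submodule.span ℂ (Submonoid.closure (Set.range e) : Set B) : Set B))
    {L' : Type*} [NormedAddCommGroup L'] [InnerProductSpace ℂ L'] [CompleteSpace L']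
    (θ : B →⋆ₐ[ℂ] (L →L[ℂ] L)) (π : B →⋆ₐ[ℂ] (L' →L[ℂ] L')) (x y : L) (x' y' : L')
    (h : ∀ b ∈ Submonoid.closure (Set.range e), ⟪x, θ b y⟫_ℂ = ⟪x', π b y'⟫_ℂ) (b : B) :
    ⟪x, θ b y⟫_ℂ = ⟪x', π b y'⟫_ℂ := by
  let f : B →ₗ[ℂ] ℂ :=
    { toFun := fun b => ⟪x, θ b y⟫_ℂ - ⟪x', π b y'⟫_ℂ
      map_add' := fun a b => by
        simp only [map_add, add_apply, inner_add_right]; ring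
      map_smul' := fun c b => by
        simp only [map_smul, smul_apply, inner_smul_right, RingHom.id_apply, smul_eq_mul]; ring }
  have hf : Continuous f := (continuous_const.inner (continuous_starAlgHom_apply θ y)).sub
    (continuous_const.inner (continuous_starAlgHom_apply π y'))
  exact sub_eq_zero.mp (mem_of_generators e hgen f hf ⊥ isClosed_singleton
    (fun b hb => sub_eq_zero.mpr (h b hb)) b)

end Words

/-! ### Unique extension and irreducibility -/

section LexMax

variable {B : Type*} [CStarAlgebra B] {E ι : Type*} [Fintype ι] {e : E → B} {m : ι → ι → E}
  {k : GenWord E ι → GenWord E ι → B → ℂ}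

theorem lexFamily_convex {k₁ k₂ : GenWord E ι → GenWord E ι → B → ℂ} {t : ℝ}
    (h : ∀ v, quad k v = t * quad k₁ v + (1 - t) * quad k₂ v) (j : ℕ ×ₗ WordComb E ι) :
    lexFamily m j k = t * lexFamily m j k₁ + (1 - t) * lexFamily m j k₂ := by
  obtain ⟨⟨d, v⟩, rfl⟩ := toLex.surjective j
  rcases d with _ | d
  · simp only [lexFamily_zero, h, Finset.sum_add_distrib, Finset.mul_sum]
  · rw [lexFamily_succ, lexFamily_succ, lexFamily_succ]
    split_ifs
    · exact h v
    · simp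

namespace IsLexMaxKernel

variable (hk : IsLexMaxKernel e m k)

/-- Rigidity for the GNS space of the kernel itself: compressions of words are already genuine words
there. -/
theorem wordVec_eq_vec (l : List E) (i : ι) :
    wordVec e hk.rep (fun i => hk.vec ([], i)) l i = hk.vec (l, i) :=
  hk.eq_wordVec hk.rep (ζ := hk.vec)
    (fun w w' => by simpa using hk.inner_vec w w' 1)
    (fun w l i s => hk.inner_vec w (l, i) (e s)) l i

theorem rep_vec_cons (s : E) (l : List E) (i : ι) :
    hk.rep (e s) (hk.vec (l, i)) = hk.vec (s :: l, i) := by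
  rw [← hk.wordVec_eq_vec, ← hk.wordVec_eq_vec]
  rfl

theorem inner_vec_vec (w w' : GenWord E ι) : ⟪hk.vec w, hk.vec w'⟫_ℂ = k w w' 1 := by
  simpa using hk.inner_vec w w' 1

theorem sum_norm_sq_vec : ∑ i, ‖hk.vec ([], i)‖ ^ 2 = 1 := by
  have := hk.trace_one
  simp only [← hk.inner_vec_vec, inner_self_eq_norm_sq_to_K,
    RCLike.ofReal_eq_complex_ofReal] at this
  exact_mod_cast this

theorem sum_quad_matrixRow :
    ∑ i, quad k (matrixRow m i) = ∑ i, ‖∑ j, hk.rep (e (m i j)) (hk.vec ([], j))‖ ^ 2 := by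
  simp only [quad_eq_norm_sq hk.inner_vec_vec, linearCombination_matrixRow, hk.rep_vec_cons]

theorem exists_vec_of_mem_closure {L : Type*} [NormedAddCommGroup L] [InnerProductSpace ℂ L]
    [CompleteSpace L] (θ : B →⋆ₐ[ℂ] (L →L[ℂ] L)) {ζ : GenWord E ι → L}
    (hζ : ∀ s l i, θ (e s) (ζ (l, i)) = ζ (s :: l, i)) {b : B}
    (hb : b ∈ Submonoid.closure (Set.range e)) (w : GenWord E ι) :
    ∃ w', θ b (ζ w) = ζ w' ∧ hk.rep b (hk.vec w) = hk.vec w' := by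
  induction hb using Submonoid.closure_induction_left with
  | one => exact ⟨w, by simp, by simp⟩
  | mul_left x hx y hy ih =>
    obtain ⟨s, rfl⟩ := hx
    obtain ⟨w', h1, h2⟩ := ih
    refine ⟨(s :: w'.1, w'.2), ?_, ?_⟩
    · rw [map_mul, mul_apply_eq_comp, h1, ← hζ]
    · rw [map_mul, mul_apply_eq_comp, h2, ← hk.rep_vec_cons]

theorem dense_span_vec
    (hgen : Dense (Submodule.span ℂ (Submonoid.closure (Set.range e) : Set B) : Set B)) : Dense (Submodule.span ℂ (Set.range hk.vec) : Set hk.Space) := by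
  rw [Submodule.dense_iff_topologicalClosure_eq_top, eq_top_iff,
    ← Submodule.dense_iff_topologicalClosure_eq_top.mp hk.dense_span_rep_vec]
  refine Submodule.topologicalClosure_minimal _ ?_ (Submodule.isClosed_topologicalClosure _)
  rw [Submodule.span_le]
  rintro _ ⟨⟨b, w⟩, rfl⟩
  refine mem_of_generators e hgen
    ((LinearMap.applyₗ (hk.vec w)).comp ((ContinuousLinearMap.coeLM ℂ).comp
      hk.rep.toAlgHom.toLinearMap)) (continuous_starAlgHom_apply hk.rep (hk.vec w)) _
      (Submodule.isClosed_topologicalClosure _) (fun b hb => ?_) b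
  obtain ⟨w', h, -⟩ := hk.exists_vec_of_mem_closure hk.rep hk.rep_vec_cons hb w
  exact Submodule.le_topologicalClosure _ (Submodule.subset_span ⟨w', h.symm⟩)

/-- Any dilation, by a representation, of a linear map that agrees with the representation of a
lexicographically maximal kernel on the letters, is a dilation of that representation. -/
theorem inner_eq_of_dilation
    (hgen : Dense (Submodule.span ℂ (Submonoid.closure (Set.range e) : Set B) : Set B))
    {L : Type*} [NormedAddCommGroup L] [InnerProductSpace ℂ L]
    [CompleteSpace L] (θ : B →⋆ₐ[ℂ] (L →L[ℂ] L)) {V : hk.Space → L}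
    (hV1 : ∀ x y, ⟪V x, V y⟫_ℂ = ⟪x, y⟫_ℂ)
    (hV : ∀ x y s, ⟪V x, θ (e s) (V y)⟫_ℂ = ⟪x, hk.rep (e s) y⟫_ℂ) (b : B)
    (u w : GenWord E ι) :
    ⟪V (hk.vec u), θ b (V (hk.vec w))⟫_ℂ = ⟪hk.vec u, hk.rep b (hk.vec w)⟫_ℂ := by
  have hword := hk.eq_wordVec θ (ζ := fun w => V (hk.vec w))
    (fun w w' => (hV1 _ _).trans (hk.inner_vec_vec w w'))
    (fun w l i s => (hV _ _ s).trans (hk.inner_vec w (l, i) (e s)))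
  have hζ : ∀ s l i, θ (e s) (V (hk.vec (l, i))) = V (hk.vec (s :: l, i)) := by
    intro s l i
    rw [← hword, ← hword]
    rfl
  refine inner_eq_of_generators e hgen θ hk.rep _ _ _ _ (fun b hb => ?_) b
  obtain ⟨w', h, h'⟩ := hk.exists_vec_of_mem_closure θ (ζ := fun w => V (hk.vec w)) hζ hb w
  rw [h, h', hV1]

/-- The representation of a lexicographically maximal kernel has the unique extension property. -/
theorem unique_extension
    (hgen : Dense (Submodule.span ℂ (Submonoid.closure (Set.range e) : Set B) : Set B))
    [PartialOrder B] [StarOrderedRing B]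
    (ψ : B →CP (hk.Space →L[ℂ] hk.Space)) (h1 : ψ 1 = 1) (hψ : ∀ s, ψ (e s) = hk.rep (e s))
    (b : B) : ψ b = hk.rep b := by
  have key : ∀ u w, ⟪hk.vec u, ψ b (hk.vec w)⟫_ℂ = ⟪hk.vec u, hk.rep b (hk.vec w)⟫_ℂ := by
    intro u w
    have hp := ψ.isPosDefKernel
    -- The dilation is the Stinespring space of ψ; unitality of ψ makes `hp.vec` preserve inner
    -- products.
    rw [← hk.inner_eq_of_dilation hgen hp.rep (V := hp.vec) (fun x y => ?_) (fun x y s => ?_) b u w]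
    · exact (hp.inner_vec _ _ b).symm
    · have := hp.inner_vec x y 1
      rwa [map_one, h1] at this
    · rw [← hψ]
      exact hp.inner_vec x y (e s)
  refine ContinuousLinearMap.ext_on (hk.dense_span_vec hgen) ?_
  rintro _ ⟨w, rfl⟩
  rw [← sub_eq_zero]
  refine (hk.dense_span_vec hgen).eq_zero_of_inner_right ℂ fun v hv => ?_
  induction hv using Submodule.span_induction with
  | mem x hx =>
    obtain ⟨u, rfl⟩ := hx
    rw [inner_sub_right, key, sub_self]
  | zero => simp
  | add x y _ _ hx hy => rw [inner_add_left, hx, hy, add_zero]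
  | smul c x _ hx => rw [inner_smul_left, hx, mul_zero]

/-- Cutting down a moment kernel by an operator that commutes with the representation. -/
theorem exists_isMomentKernel_of_commute {T : hk.Space →L[ℂ] hk.Space}
    (hT : ∀ b x, T (hk.rep b x) = hk.rep b (T x)) {t : ℝ}
    (ht : ∑ i, ‖T (hk.vec ([], i))‖ ^ 2 = t) (ht0 : 0 < t) :
    ∃ k', IsMomentKernel e k' ∧
      ∀ v, t * quad k' v = ‖T (Finsupp.linearCombination ℂ hk.vec v)‖ ^ 2 := by
  -- Rescaling by 1/√t restores total squared norm one for the vectors cut down by T.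
  let c : ℝ := (Real.sqrt t)⁻¹
  have hc : c ^ 2 * t = 1 := by
    rw [inv_pow, Real.sq_sqrt ht0.le, inv_mul_cancel₀ ht0.ne']
  have hc0 : 0 ≤ c := inv_nonneg.mpr (Real.sqrt_nonneg t)
  have hcT : ∀ x, ‖((c : ℂ) • T) x‖ ^ 2 = c ^ 2 * ‖T x‖ ^ 2 := fun x => by
    rw [smul_apply, norm_smul, mul_pow, Complex.norm_real, Real.norm_of_nonneg hc0]
  have hcomm : ∀ b x, ((c : ℂ) • T) (hk.rep b x) = hk.rep b (((c : ℂ) • T) x) := fun b x => by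
    rw [smul_apply, smul_apply, map_smul, hT]
  refine ⟨momentKernel e hk.rep fun i => ((c : ℂ) • T) (hk.vec ([], i)),
    isMomentKernel_momentKernel e hk.rep ?_, fun v => ?_⟩
  · simp only [hcT]
    rw [← Finset.mul_sum, ht, hc]
  · have hgram : ∀ w w', ⟪((c : ℂ) • T) (hk.vec w), ((c : ℂ) • T) (hk.vec w')⟫_ℂ =
        momentKernel e hk.rep (fun i => ((c : ℂ) • T) (hk.vec ([], i))) w w' 1 := fun w w' => by
      rw [momentKernel, map_one, one_apply_eq_self,
        wordVec_map e hk.rep (fun i => hk.vec ([], i)) _ hcomm,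
        wordVec_map e hk.rep (fun i => hk.vec ([], i)) _ hcomm, hk.wordVec_eq_vec,
        hk.wordVec_eq_vec]
    rw [quad_eq_norm_sq hgram]
    have : Finsupp.linearCombination ℂ (fun w => ((c : ℂ) • T) (hk.vec w)) v =
        ((c : ℂ) • T) (Finsupp.linearCombination ℂ hk.vec v) := by
      rw [Finsupp.linearCombination_apply, Finsupp.linearCombination_apply, map_finsuppSum]
      simp only [map_smul]
    rw [this, hcT, ← mul_assoc, mul_comm t, hc, one_mul]

/-- The representation of a lexicographically maximal kernel is irreducible. -/
theorem isIrreducibleRep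
    (hgen : Dense (Submodule.span ℂ (Submonoid.closure (Set.range e) : Set B) : Set B)) : IsIrreducibleRep hk.rep where
  nontrivial := by
    by_contra h
    have := not_nontrivial_iff_subsingleton.mp h
    have h1 := hk.sum_norm_sq_vec
    simp [Subsingleton.elim _ (0 : hk.Space)] at h1
  eq_bot_or_eq_top K hKc hK := by
    have : CompleteSpace K := hKc.completeSpace_coe
    have hQ := starProjection_commute_of_invariant hK
    have hQ' := starProjection_commute_of_invariant (orthogonal_invariant_of_invariant hK)
    have hpyth := fun x => K.norm_sq_eq_add_norm_sq_starProjection x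
    set t := ∑ i, ‖K.starProjection (hk.vec ([], i))‖ ^ 2 with ht
    have ht' : ∑ i, ‖Kᗮ.starProjection (hk.vec ([], i))‖ ^ 2 = 1 - t := by
      rw [← hk.sum_norm_sq_vec, ht, ← Finset.sum_sub_distrib]
      exact Finset.sum_congr rfl fun i _ => by
        rw [hpyth (hk.vec ([], i))]; ring
    -- An operator in the commutant that kills the generators kills every word, hence a dense
    -- subspace. This disposes of t = 0 and t = 1.
    have hvanish : ∀ T : hk.Space →L[ℂ] hk.Space, (∀ b x, T (hk.rep b x) = hk.rep b (T x)) →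
        ∑ i, ‖T (hk.vec ([], i))‖ ^ 2 = 0 → T = 0 := by
      intro T hT h0
      have h1 : (fun i => T (hk.vec ([], i))) = fun _ => 0 := by
        funext i
        have := (Finset.sum_eq_zero_iff_of_nonneg fun i _ => sq_nonneg _).mp h0 i
          (Finset.mem_univ i)
        simpa using this
      have h2 : ∀ l i, wordVec e hk.rep (fun _ : ι => (0 : hk.Space)) l i = 0 := by
        intro l i
        simpa using wordVec_map e hk.rep (fun _ : ι => (0 : hk.Space)) 0 (by simp) l i
      refine ContinuousLinearMap.ext_on (hk.dense_span_vec hgen) ?_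
      rintro _ ⟨⟨l, i⟩, rfl⟩
      rw [← hk.wordVec_eq_vec, ← wordVec_map e hk.rep _ T hT, h1, h2]
      rfl
    have ht0 : 0 ≤ t := Finset.sum_nonneg fun i _ => sq_nonneg _
    have ht1 : 0 ≤ 1 - t := ht' ▸ Finset.sum_nonneg fun i _ => sq_nonneg _
    rcases ht0.eq_or_lt with h0 | h0
    · left
      have := hvanish _ hQ (ht.symm.trans h0.symm)
      refine (Submodule.eq_bot_iff K).mpr fun x hx => ?_
      rw [← Submodule.starProjection_eq_self_iff.mpr hx, this]
      rfl
    rcases ht1.eq_or_lt with h1 | h1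
    · right
      have := hvanish _ hQ' (ht'.trans h1.symm)
      refine (Submodule.eq_top_iff').mpr fun x => ?_
      rw [K.mem_iff_norm_starProjection]
      have hx := hpyth x
      rw [this] at hx
      simpa using hx.symm
    obtain ⟨k₁, hk₁, hq₁⟩ := hk.exists_isMomentKernel_of_commute hQ ht.symm h0
    obtain ⟨k₂, hk₂, hq₂⟩ := hk.exists_isMomentKernel_of_commute hQ' ht' h1
    -- Pythagoras for K and its complement, with weights t and 1 − t undoing the rescaling.
    have hconv : ∀ v, quad k v = t * quad k₁ v + (1 - t) * quad k₂ v := fun v => by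
      rw [hq₁, hq₂, quad_eq_norm_sq hk.inner_vec_vec, hpyth]
    have hlex := eq_of_lex_max_of_convex hk.lex_max hk₁ hk₂ h0 (by linarith)
      (lexFamily_convex hconv)
    have hspan : ∀ x, ‖K.starProjection x‖ ^ 2 = t * ‖x‖ ^ 2 := by
      intro x
      refine (hk.dense_span_vec hgen).induction (P := fun x =>
        ‖K.starProjection x‖ ^ 2 = t * ‖x‖ ^ 2) (fun x hx => ?_)
        (isClosed_eq (by fun_prop) (by fun_prop)) x
      obtain ⟨v, rfl⟩ := (Finsupp.mem_span_range_iff_exists_finsupp).mp hx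
      change ‖K.starProjection (Finsupp.linearCombination ℂ hk.vec v)‖ ^ 2 =
        t * ‖Finsupp.linearCombination ℂ hk.vec v‖ ^ 2
      rw [← hq₁, ← quad_eq_norm_sq hk.inner_vec_vec, quad_eq_of_lexFamily_eq le_rfl (hlex _)]
    left
    refine (Submodule.eq_bot_iff K).mpr fun x hx => ?_
    have hx' := hspan x
    rw [Submodule.starProjection_eq_self_iff.mpr hx] at hx'
    have : ‖x‖ ^ 2 = 0 := by nlinarith [sq_nonneg ‖x‖]
    simpa using this

end IsLexMaxKernel

end LexMax

/-! ### Norming states -/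

section State

variable {D : Type*} [CStarAlgebra D] [PartialOrder D] [StarOrderedRing D]

/-- Every positive element of a unital C⋆-algebra is normed by a state. -/
theorem CStarAlgebra.exists_state_norm_le [Nontrivial D] {a : D} (ha : 0 ≤ a) :
    ∃ F : D →ₗ[ℂ] ℂ, F 1 = 1 ∧ (∀ x, 0 ≤ (F (star x * x)).re) ∧
      (∀ x, F (star x) = star (F x)) ∧ ‖a‖ ≤ (F a).re := by
  have hsa : star a = a := (IsSelfAdjoint.of_nonneg ha).star_eq
  -- A functional that is nonnegative on C kills skew-adjoint elements, is positive, and is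
  -- nonnegative at a − ‖a‖·1, which the r-term puts in C.
  let C : PointedCone ℝ D :=
    { carrier := {x | ∃ r : ℝ, 0 ≤ r ∧ 0 ≤ x + star x + r • (‖a‖ • (1 : D) - a)}
      add_mem' := by
        rintro x y ⟨r, hr, hx⟩ ⟨s, hs, hy⟩
        refine ⟨r + s, add_nonneg hr hs, (add_nonneg hx hy).trans_eq ?_⟩
        rw [star_add, add_smul]; abel
      zero_mem' := ⟨0, le_rfl, by simp⟩
      smul_mem' := by
        rintro ⟨c, hc⟩ x ⟨r, hr, hx⟩
        refine ⟨c * r, mul_nonneg hc hr, (smul_nonneg hc hx).trans_eq ?_⟩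
        change _ = c • x + star (c • x) + _
        rw [star_smul, (star_trivial c : star c = c), smul_add, smul_add, mul_smul] }
  have hC : ∀ x, x ∈ C ↔ ∃ r : ℝ, 0 ≤ r ∧ 0 ≤ x + star x + r • (‖a‖ • (1 : D) - a) :=
    fun x => Iff.rfl
  obtain ⟨g, hg1, hgC⟩ := riesz_extension C
    (LinearPMap.mkSpanSingleton (K := ℝ) (1 : D) (1 : ℝ) one_ne_zero) (by
      rintro ⟨x, hx⟩ hxC
      obtain ⟨c, rfl⟩ := Submodule.mem_span_singleton.mp hx
      obtain ⟨r, hr, h⟩ := (hC _).mp hxC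
      refine le_of_le_of_eq (b := c) ?_
        ((LinearPMap.mkSpanSingleton'_apply (σ := RingHom.id ℝ) (1 : D) (1 : ℝ) _ c hx).trans
          (mul_one c)).symm
      -- Taking norms gives r‖a‖ ≤ 2c + r‖a‖, hence c ≥ 0; the right side cannot be negative since r
      -- • a is positive and 1 ≠ 0.
      have hle : r • a ≤ algebraMap ℝ D (2 * c + r * ‖a‖) := by
        rw [← sub_nonneg]
        refine h.trans_eq ?_
        rw [Algebra.algebraMap_eq_smul_one]
        change c • (1 : D) + star (c • (1 : D)) + _ = _
        rw [star_smul, star_one, star_trivial]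
        module
      have hra : 0 ≤ r • a := smul_nonneg hr ha
      rcases le_or_gt 0 (2 * c + r * ‖a‖) with hs | hs
      · have := (CStarAlgebra.norm_le_iff_le_algebraMap (r • a) hs hra).mpr hle
        rw [norm_smul, Real.norm_of_nonneg hr] at this
        linarith
      · exfalso
        have h1 : 0 ≤ algebraMap ℝ D (2 * c + r * ‖a‖) := hra.trans hle
        have h2 : 0 ≤ (-(2 * c + r * ‖a‖)) • (1 : D) := smul_nonneg (by linarith) zero_le_one
        rw [Algebra.algebraMap_eq_smul_one] at h1
        rw [neg_smul, neg_nonneg] at h2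
        rcases smul_eq_zero.mp (le_antisymm h2 h1) with h3 | h3
        · linarith
        · exact one_ne_zero h3)
    (by
      intro y
      refine ⟨⟨‖y‖ • (1 : D), Submodule.smul_mem _ _ (Submodule.mem_span_singleton_self 1)⟩,
        0, le_rfl, ?_⟩
      have h1 : IsSelfAdjoint (y + star y) := IsSelfAdjoint.add_star_self y
      have h2 := h1.neg_algebraMap_norm_le_self
      have h3 : algebraMap ℝ D ‖y + star y‖ ≤ algebraMap ℝ D (2 * ‖y‖) := by
        refine algebraMap_mono D ?_
        calc ‖y + star y‖ ≤ ‖y‖ + ‖star y‖ := norm_add_le _ _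
          _ = 2 * ‖y‖ := by rw [norm_star]; ring
      have h4 : 0 ≤ algebraMap ℝ D (2 * ‖y‖) + (y + star y) :=
        (neg_le_iff_add_nonneg'.mp h2).trans (add_le_add_left h3 _)
      refine h4.trans_eq ?_
      rw [Algebra.algebraMap_eq_smul_one]
      simp only [star_add, star_smul, star_one, star_trivial]
      module)
  have hg_one : g 1 = 1 := by
    have := hg1 ⟨1, Submodule.mem_span_singleton_self 1⟩
    rw [this]
    exact LinearPMap.mkSpanSingleton_apply ℝ ℝ one_ne_zero (1 : ℝ)
  have hg_skew : ∀ x, star x = -x → g x = 0 := by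
    intro x hx
    have h1 := hgC x ((hC x).mpr ⟨0, le_rfl, by simp [hx]⟩)
    have h2 := hgC (-x) ((hC _).mpr ⟨0, le_rfl, by simp [hx]⟩)
    rw [map_neg] at h2
    linarith
  refine ⟨Module.Dual.extendRCLike (𝕜 := ℂ) g, ?_, fun x => ?_, fun x => ?_, ?_⟩
  · rw [Module.Dual.extendRCLike_apply, hg_one, hg_skew (RCLike.I • 1) (by simp)]
    simp
  · have h : (Module.Dual.extendRCLike (𝕜 := ℂ) g (star x * x)).re = g (star x * x) :=
      Module.Dual.re_extendRCLike_apply (𝕜 := ℂ) g _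
    rw [h]
    refine hgC _ ((hC _).mpr ⟨0, le_rfl, ?_⟩)
    simpa using add_nonneg (star_mul_self_nonneg x) (star_mul_self_nonneg x)
  · have h1 : g (star x) = g x := by
      rw [← sub_eq_zero, ← map_sub]
      exact hg_skew _ (by simp)
    have h2 : g ((RCLike.I : ℂ) • star x) = -g ((RCLike.I : ℂ) • x) := by
      rw [← add_eq_zero_iff_eq_neg, ← map_add]
      exact hg_skew _ (by simp [add_comm])
    rw [Module.Dual.extendRCLike_apply, Module.Dual.extendRCLike_apply, h1, h2]
    simp
  · have h : (Module.Dual.extendRCLike (𝕜 := ℂ) g a).re = g a :=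
      Module.Dual.re_extendRCLike_apply (𝕜 := ℂ) g _
    rw [h]
    -- The value r = 2 cancels x + x* = 2(a − ‖a‖·1) exactly.
    have h1 := hgC (a - ‖a‖ • (1 : D)) ((hC _).mpr ⟨2, zero_le_two, by
      rw [star_sub, star_smul, star_one, (star_trivial ‖a‖ : star ‖a‖ = ‖a‖), hsa]
      refine le_of_eq ?_
      module⟩)
    rw [map_sub, map_smul, hg_one, smul_eq_mul, mul_one] at h1
    linarith

end State

/-! ### Attaining the norm of a matrix in a representation -/

section MatrixState

variable {B : Type u} [CStarAlgebra B] {ι : Type} [Fintype ι]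

theorem CStarMatrix.norm_map_le [PartialOrder B] [StarOrderedRing B] {L : Type*}
    [NormedAddCommGroup L] [InnerProductSpace ℂ L] [CompleteSpace L]
    (π : B →⋆ₐ[ℂ] (L →L[ℂ] L)) (M : CStarMatrix ι ι B) : ‖M.map π‖ ≤ ‖M‖ := by
  classical
  exact NonUnitalStarAlgHom.norm_apply_le
    (CStarMatrix.mapₙₐ (n := ι) (π : B →⋆ₙₐ[ℂ] (L →L[ℂ] L))) M

theorem CStarMatrix.sum_norm_sq_map_le {L : Type*} [NormedAddCommGroup L]
    [InnerProductSpace ℂ L] [CompleteSpace L] (π : B →⋆ₐ[ℂ] (L →L[ℂ] L)) (M : CStarMatrix ι ι B)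
    {η : ι → L} (hη : ∑ i, ‖η i‖ ^ 2 = 1) :
    ∑ i, ‖∑ j, π (M i j) (η j)‖ ^ 2 ≤ ‖M.map π‖ ^ 2 := by
  have h := CStarMatrix.sum_norm_sq_le (M.map π) η
  rwa [hη, mul_one] at h

/-- The norm of a matrix over a C⋆-algebra is attained in a representation. -/
theorem CStarMatrix.exists_rep_norm_le [PartialOrder B] [StarOrderedRing B] [Nonempty ι]
    [Nontrivial B] (M : CStarMatrix ι ι B) :
    ∃ (L : Type u) (_ : NormedAddCommGroup L) (_ : InnerProductSpace ℂ L) (_ : CompleteSpace L)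
      (π : B →⋆ₐ[ℂ] (L →L[ℂ] L)) (η : ι → L), ∑ i, ‖η i‖ ^ 2 = 1 ∧
      ‖M‖ ^ 2 ≤ ∑ i, ‖∑ j, π (M i j) (η j)‖ ^ 2 := by
  classical
  obtain ⟨F, hF1, hFpos, hFstar, hFM⟩ := CStarAlgebra.exists_state_norm_le (star_mul_self_nonneg M)
  -- The state on matrices is cut into its entry functionals; GNS for this kernel represents B
  -- itself, with one vector per index.
  let k : ι → ι → B → ℂ := fun i j b => F (CStarMatrix.ofMatrix (Matrix.single i j b))
  have hFk : ∀ N : CStarMatrix ι ι B, F N = ∑ i, ∑ j, k i j (N i j) := by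
    intro N
    simp only [k, ← map_sum]
    congr 1
    exact Matrix.matrix_eq_sum_single (CStarMatrix.ofMatrix.symm N)
  have hk : IsPosDefKernel k :=
    { map_add := fun i j a b => by
        simp only [k, ← map_add]
        congr 1
        exact Matrix.single_add i j a b
      map_smul := fun i j c a => by
        simp only [k, ← smul_eq_mul, ← map_smul]
        congr 1
        exact (Matrix.smul_single c i j a).symm
      map_star := fun i j a => by
        simp only [k, ← hFstar]
        congr 1
        exact (Matrix.conjTranspose_single i j a).symm
      nonneg := fun u => by
        obtain ⟨i₀⟩ := ‹Nonempty ι›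
        -- A single nonzero row makes the entries of R*R exactly the products in the kernel form.
        let R : CStarMatrix ι ι B := CStarMatrix.ofMatrix fun l j => if l = i₀ then u j else 0
        have hR : ∀ i j, (star R * R) i j = star (u i) * u j := by
          intro i j
          rw [CStarMatrix.mul_apply]
          change ∑ l, star (if l = i₀ then u i else 0) * (if l = i₀ then u j else 0) = _
          simp
        refine (hFpos R).trans_eq ?_
        rw [hFk, kernelForm, Finsupp.sum_fintype _ _ (by simp [Finsupp.sum, k])]
        simp only [hR]
        congr 1
        refine Finset.sum_congr rfl fun i _ => ?_
        rw [Finsupp.sum_fintype _ _ (by simp [k])] }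
  have hval : ∀ N : CStarMatrix ι ι B,
      F N = ∑ i, ∑ j, ⟪hk.vec i, N.map hk.rep i j (hk.vec j)⟫_ℂ := by
    intro N
    simp only [hFk, CStarMatrix.map_apply, hk.inner_vec]
  refine ⟨hk.Space, inferInstance, inferInstance, inferInstance, hk.rep, hk.vec, ?_, ?_⟩
  · have h := hval 1
    rw [hF1] at h
    have h1 : ∀ i, ∑ j, ⟪hk.vec i, (1 : CStarMatrix ι ι B).map hk.rep i j (hk.vec j)⟫_ℂ =
        ((‖hk.vec i‖ ^ 2 : ℝ) : ℂ) := by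
      intro i
      rw [Finset.sum_eq_single i]
      · simp
      · intro j _ hj
        simp [hj.symm]
      · simp
    simp only [h1] at h
    exact_mod_cast h.symm
  · rw [CStarRing.norm_star_mul_self, ← sq] at hFM
    refine hFM.trans_eq ?_
    have hmap : (star M * M).map hk.rep = star (M.map hk.rep) * M.map hk.rep := by
      refine CStarMatrix.ext fun i j => ?_
      simp only [CStarMatrix.map_apply, CStarMatrix.mul_apply, CStarMatrix.star_apply, map_sum,
        map_mul, map_star]
    rw [hval, hmap, CStarMatrix.sum_inner_star_mul, Complex.re_sum]
    exact Finset.sum_congr rfl fun i _ => inner_self_eq_norm_sq (𝕜 := ℂ) _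

end MatrixState

/-! ### Application to operator systems -/

namespace OperatorSystem

variable {A : Type u} [CStarAlgebra A] (S : OperatorSystem A)

/-- Since 𝒮 is self-adjoint, the star-algebra it generates is the plain algebra it generates,
spanned by products of elements of 𝒮. -/
theorem dense_span_closure_incl :
    Dense (Submodule.span ℂ (Submonoid.closure (Set.range S.incl) : Set S.cstar) :
      Set S.cstar) := by
  intro b
  rw [closure_subtype]
  refine closure_mono ?_ b.2
  intro a ha
  have h1 : a ∈ Algebra.adjoin ℂ (S.toSubmodule : Set A) := by
    have h : a ∈ (StarAlgebra.adjoin ℂ (S.toSubmodule : Set A)).toSubalgebra := ha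
    rw [StarAlgebra.adjoin_toSubalgebra, Set.union_eq_self_of_subset_right] at h
    · exact h
    · intro x hx
      simpa using S.star_mem' (Set.mem_star.mp hx)
  rw [← Subalgebra.mem_toSubmodule, Algebra.adjoin_eq_span] at h1
  have h2 : (Submonoid.closure (S.toSubmodule : Set A) : Set A) =
      S.cstar.subtype '' (Submonoid.closure (Set.range S.incl) : Set S.cstar) := by
    have h3 : (S.toSubmodule : Set A) = S.cstar.subtype '' Set.range S.incl := by
      ext x
      simp only [Set.mem_image, Set.mem_range, exists_exists_eq_and]
      exact ⟨fun hx => ⟨⟨x, hx⟩, rfl⟩, fun ⟨y, hy⟩ => hy ▸ y.2⟩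
    rw [h3]
    exact congrArg SetLike.coe (MonoidHom.map_mclosure (S.cstar.subtype : S.cstar →* A)
      (Set.range S.incl)).symm
  rw [h2] at h1
  have h4 := Submodule.map_span (S.cstar.subtype.toAlgHom.toLinearMap)
    (Submonoid.closure (Set.range S.incl) : Set S.cstar)
  have h5 : a ∈ Submodule.map (S.cstar.subtype.toAlgHom.toLinearMap)
      (Submodule.span ℂ (Submonoid.closure (Set.range S.incl) : Set S.cstar)) := by
    rw [h4]; exact h1
  exact h5

theorem exists_isBoundaryRepresentation_norm_eq [Nontrivial A] {n : ℕ} [NeZero n]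
    (M : CStarMatrix (Fin n) (Fin n) S.toSubmodule) :
    ∃ (H : Type u) (_ : NormedAddCommGroup H) (_ : InnerProductSpace ℂ H) (_ : CompleteSpace H)
      (π : S.cstar →⋆ₐ[ℂ] (H →L[ℂ] H)),
      S.IsBoundaryRepresentation π ∧ ‖(M.map S.incl).map π‖ = ‖M.map S.incl‖ := by
  obtain ⟨L, _, _, _, π₀, η, hη, hM⟩ := CStarMatrix.exists_rep_norm_le (M.map S.incl)
  obtain ⟨k, hk, hle⟩ := exists_isLexMaxKernel S.incl (fun i j => M i j)
    (isMomentKernel_momentKernel S.incl π₀ hη)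
  have hgen := S.dense_span_closure_incl
  refine ⟨hk.Space, inferInstance, inferInstance, inferInstance, hk.rep,
    ⟨hk.isIrreducibleRep hgen, hk.unique_extension hgen⟩, le_antisymm ?_ ?_⟩
  · exact CStarMatrix.norm_map_le hk.rep (M.map S.incl)
  · have h1 : ∑ i, quad (momentKernel S.incl π₀ η) (matrixRow (fun i j => M i j) i) =
        ∑ i, ‖∑ j, π₀ (S.incl (M i j)) (η j)‖ ^ 2 := by
      simp only [quad_eq_norm_sq (ξ := fun w => wordVec S.incl π₀ η w.1 w.2)
        (k := momentKernel S.incl π₀ η) fun w w' => by simp [momentKernel],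
        linearCombination_matrixRow]
      rfl
    rw [h1, hk.sum_quad_matrixRow] at hle
    have h2 := CStarMatrix.sum_norm_sq_map_le hk.rep (M.map S.incl) hk.sum_norm_sq_vec
    exact (abs_le_of_sq_le_sq' ((hM.trans hle).trans h2) (norm_nonneg _)).2

end OperatorSystem

theorem theorem3p1 {A : Type u} [CStarAlgebra A] [Nontrivial A] (S : OperatorSystem A)
    (n : ℕ) (M : CStarMatrix (Fin n) (Fin n) S.toSubmodule) :
    ∃ (H : Type u) (_ : NormedAddCommGroup H) (_ : InnerProductSpace ℂ H) (_ : CompleteSpace H)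
      (π : S.cstar →⋆ₐ[ℂ] (H →L[ℂ] H)),
      S.IsBoundaryRepresentation π ∧ ‖(M.map S.incl).map π‖ = ‖M.map S.incl‖ := by
  rcases n with _ | n
  -- For n = 0 both norms vanish, but a boundary representation must still exist; the 1×1 case
  -- supplies one.
  · obtain ⟨H, i1, i2, i3, π, hπ, -⟩ :=
      S.exists_isBoundaryRepresentation_norm_eq (0 : CStarMatrix (Fin 1) (Fin 1) S.toSubmodule)
    refine ⟨H, i1, i2, i3, π, hπ, ?_⟩
    have h1 : (M.map S.incl).map π = 0 := CStarMatrix.ext fun i => i.elim0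
    have h2 : M.map S.incl = 0 := CStarMatrix.ext fun i => i.elim0
    rw [h1, h2, norm_zero, norm_zero]
  · exact S.exists_isBoundaryRepresentation_norm_eq M
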